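/- For a positive integer $n$ let $s(n)=\sum_{d\mid n,\ d<n} d$ denote the sum of the proper divisors of $n$. Let $\epsilon=\epsilon(x)$ be a fixed real-valued function with $\epsilon(x)\to 0$ as $x\to\infty$. Then, as $x\to\infty$, $$\#\{n\le x: s(n)\in\mathcal{A}\}=o_\epsilon(x)$$ uniformly over all sets $\mathcal{A}$ of at most $x^{1/2+\epsilon(x)}$ positive integers. That is, for every $\delta>0$ there is an $x_0=x_0(\delta,\epsilon)$ such that for every real $x\ge x_0$ and every set $\mathcal{A}$ of positive integers with $\#\mathcal{A}\le x^{1/2+\epsilon(x)}$, the number of positive integers $n\le x$ with $s(n)\in\mathcal{A}$ is at most $\delta x$. -/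

import Mathlib

/-- The sum-of-proper-divisors function `s(n) = ∑_{d ∣ n, d < n} d = σ(n) - n`. -/
def sumProperDivisors (n : ℕ) : ℕ := ∑ d ∈ n.properDivisors, d

/-- The set of positive integers `n ≤ x` with `s(n) ∈ A`. -/
noncomputable def preimagesUpTo (A : Finset ℕ) (x : ℝ) : Finset ℕ :=
  (Finset.Icc 1 ⌊x⌋₊).filter (fun n => sumProperDivisors n ∈ A)

/-! Discarding few `n ≤ x`, one may write `n = m p` with `p > x ^ κ` prime, `p ∤ m`, and `m`
divisible by a prime `q ≤ z`. The discarded `n` are `x ^ κ`-smooth, divisible by a large square, or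
free of primes up to `z`.

Here `s(n) = s(m) p + s(m) + m` is linear in `p`. Cauchy–Schwarz over the at most `x ^ (1 - κ)`
cofactors `m` reduces the count to pairs `n ≠ n'` sharing `m`. Fix `a = s(n)` and `b = s(n')`: then
`s(m)` divides `a - b ≠ 0`, leaving `x ^ o(1)` choices for `s(m)`. Moreover `m ≡ a` modulo `s(m)`
and `m ≤ z s(m)` leave at most `z` choices of `m`, which then determines both primes. So the pairs
number at most `z x ^ o(1) |A| ^ 2`, and the factor `x ^ (-κ)` gained from the range of `m` absorbs
the excess of `|A| ^ 2` over `x`. -/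

/-- The divisor bound: `d(n) ≪_θ n ^ θ`. -/
theorem exists_card_divisors_le_mul_rpow {θ : ℝ} (hθ : 0 < θ) :
    ∃ C : ℝ, 0 < C ∧ ∀ n : ℕ, n ≠ 0 → (n.divisors.card : ℝ) ≤ C * (n : ℝ) ^ θ := by
  -- `K` is chosen so that `v + 1 ≤ K (1 + v θ log 2)`; the loss is paid only at primes `p < B`,
  -- since `p ^ θ ≥ 2` beyond.
  set K : ℝ := max 1 (1 / (θ * Real.log 2)) with hK
  have hl2 : 0 < θ * Real.log 2 := mul_pos hθ (Real.log_pos (by norm_num))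
  have hK1 : 1 ≤ K := le_max_left _ _
  have hK2 : 1 ≤ K * (θ * Real.log 2) := by
    have := mul_le_mul_of_nonneg_right (le_max_right 1 (1 / (θ * Real.log 2))) hl2.le
    rwa [one_div_mul_cancel hl2.ne'] at this
  set B : ℕ := ⌈(2 : ℝ) ^ (1 / θ)⌉₊ with hB
  refine ⟨K ^ B, by positivity, fun n hn => ?_⟩
  have key : ∀ p ∈ n.primeFactors, ((n.factorization p + 1 : ℕ) : ℝ) ≤
      (if p < B then K else 1) * ((p : ℝ) ^ n.factorization p) ^ θ := by
    intro p hp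
    have hp' := Nat.prime_of_mem_primeFactors hp
    set v := n.factorization p
    have hp2 : (2 : ℝ) ≤ p := by exact_mod_cast hp'.two_le
    have hswap : ((p : ℝ) ^ v) ^ θ = ((p : ℝ) ^ θ) ^ v := by
      rw [← Real.rpow_natCast, ← Real.rpow_natCast, ← Real.rpow_mul (by positivity),
        ← Real.rpow_mul (by positivity), mul_comm]
    split_ifs with h
    · have h1 : (2 : ℝ) ^ θ ≤ (p : ℝ) ^ θ := Real.rpow_le_rpow (by norm_num) hp2 hθ.le
      have h2 : 1 + v * (θ * Real.log 2) ≤ ((p : ℝ) ^ v) ^ θ := by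
        rw [hswap]
        calc 1 + v * (θ * Real.log 2) ≤ Real.exp (v * (θ * Real.log 2)) := by
              linarith [Real.add_one_le_exp (v * (θ * Real.log 2))]
          _ = ((2 : ℝ) ^ θ) ^ v := by
              rw [Real.rpow_def_of_pos (by norm_num), ← Real.exp_nat_mul]
              ring_nf
          _ ≤ _ := pow_le_pow_left₀ (by positivity) h1 _
      push_cast
      have hv : (0 : ℝ) ≤ v := Nat.cast_nonneg _
      calc (v : ℝ) + 1 ≤ v * (K * (θ * Real.log 2)) + K := by nlinarith
        _ = K * (1 + v * (θ * Real.log 2)) := by ring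
        _ ≤ _ := by gcongr
    · have h1 : (2 : ℝ) ≤ (p : ℝ) ^ θ := by
        have h3 : (2 : ℝ) ^ (1 / θ) ≤ p :=
          (Nat.le_ceil _).trans (by exact_mod_cast not_lt.mp h)
        calc (2 : ℝ) = ((2 : ℝ) ^ (1 / θ)) ^ θ := by
              rw [← Real.rpow_mul (by norm_num), one_div_mul_cancel hθ.ne', Real.rpow_one]
          _ ≤ _ := Real.rpow_le_rpow (by positivity) h3 hθ.le
      rw [hswap, one_mul]
      calc ((v + 1 : ℕ) : ℝ) ≤ (2 : ℝ) ^ v := by exact_mod_cast Nat.lt_two_pow_self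
        _ ≤ _ := pow_le_pow_left₀ (by norm_num) h1 _
  have hcard : ∏ p ∈ n.primeFactors, (if p < B then K else 1) ≤ K ^ B := by
    rw [Finset.prod_ite, Finset.prod_const_one, mul_one, Finset.prod_const]
    refine pow_le_pow_right₀ hK1 ?_
    calc _ ≤ (Finset.range B).card := Finset.card_le_card fun p hp => by
            simpa using (Finset.mem_filter.mp hp).2
      _ = B := Finset.card_range B
  have hn' : ∏ p ∈ n.primeFactors, (((p : ℝ) ^ n.factorization p) ^ θ) = (n : ℝ) ^ θ := by
    rw [Real.finsetProd_rpow _ _ (fun _ _ => by positivity)]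
    congr 1
    conv_rhs => rw [← Nat.prod_factorization_pow_eq_self hn]
    simp [Finsupp.prod]
  rw [Nat.card_divisors hn]
  push_cast
  calc ∏ p ∈ n.primeFactors, ((n.factorization p : ℝ) + 1)
      ≤ ∏ p ∈ n.primeFactors, ((if p < B then K else 1) * ((p : ℝ) ^ n.factorization p) ^ θ) :=
        Finset.prod_le_prod (fun _ _ => by positivity) fun p hp => by simpa using key p hp
    _ = (∏ p ∈ n.primeFactors, (if p < B then K else 1)) * (n : ℝ) ^ θ := by
        rw [Finset.prod_mul_distrib, hn']
    _ ≤ _ := by gcongr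

/-! ### Elementary properties of `s` -/

/-- Multiplicativity of `σ = s + id`. The linearity in `p` drives the whole argument. -/
theorem sumProperDivisors_mul_prime {m p : ℕ} (hp : p.Prime) (hpm : ¬ p ∣ m) :
    sumProperDivisors (m * p) = sumProperDivisors m * p + sumProperDivisors m + m := by
  have hc : m.Coprime p := ((Nat.Prime.coprime_iff_not_dvd hp).mpr hpm).symm
  have h := hc.sum_divisors_mul
  rw [Nat.sum_divisors_eq_sum_properDivisors_add_self,
    Nat.sum_divisors_eq_sum_properDivisors_add_self (n := m),
    hp.sum_divisors] at h
  unfold sumProperDivisors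
  linarith

theorem sumProperDivisors_le_sq (n : ℕ) : sumProperDivisors n ≤ n ^ 2 := by
  calc sumProperDivisors n ≤ n.properDivisors.card • n :=
        Finset.sum_le_card_nsmul _ _ _ fun d hd => (Nat.mem_properDivisors.mp hd).2.le
    _ ≤ n * n := by
        rw [smul_eq_mul]
        refine Nat.mul_le_mul_right _ ((Finset.card_le_card Nat.properDivisors_subset_divisors).trans
          n.card_divisors_le_self)
    _ = n ^ 2 := (sq n).symm

/-- The proper divisor `m / q` alone makes `s(m)` this large; this bounds the choices of `m` in a
residue class modulo `s(m)`. -/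
theorem le_mul_sumProperDivisors_of_dvd {m q : ℕ} (hm : m ≠ 0) (hq : 1 < q) (hqm : q ∣ m) :
    m ≤ q * sumProperDivisors m := by
  have hmem : m / q ∈ m.properDivisors :=
    Nat.mem_properDivisors.mpr ⟨Nat.div_dvd_of_dvd hqm, Nat.div_lt_self (by omega) hq⟩
  calc m = q * (m / q) := (Nat.mul_div_cancel' hqm).symm
    _ ≤ _ := Nat.mul_le_mul_left _
        (Finset.single_le_sum (f := fun d : ℕ => d) (fun _ _ => Nat.zero_le _) hmem)

/-! ### Exceptional sets: rough numbers and large square divisors -/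

open scoped Classical in
/-- Positive integers without a prime factor `≤ z` have small density as `z` grows. -/
theorem exists_card_filter_no_small_prime_le {δ : ℝ} (hδ : 0 < δ) :
    ∃ z N₀ : ℕ, ∀ N, N₀ ≤ N →
      (((Finset.Icc 1 N).filter fun n => ∀ q, q.Prime → q ∣ n → z < q).card : ℝ) ≤ δ * N := by
  have hdiv := (not_summable_iff_tendsto_nat_atTop_of_nonneg
    (f := {p : ℕ | p.Prime}.indicator fun n : ℕ => (1 : ℝ) / n)
    (fun n => Set.indicator_nonneg (fun _ _ => by positivity) n)).mp not_summable_one_div_on_primes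
  -- Divergence of `∑ 1/p` makes `φ(P)/P ≤ exp (-∑ 1/p) ≤ δ/2` for the primorial `P` of `k`.
  obtain ⟨k, hk⟩ := (hdiv.eventually_ge_atTop (-Real.log (δ / 2))).exists_forall_of_atTop
  set P := primorial k with hP
  have hP0 : P ≠ 0 := (primorial_pos k).ne'
  have hPpos : (0 : ℝ) < P := by exact_mod_cast primorial_pos k
  have hratio : (P.totient : ℝ) ≤ δ / 2 * P := by
    have h1 : (P.totient : ℝ) = P * ∏ p ∈ P.primeFactors, (1 - (p : ℝ)⁻¹) := by
      have h := congrArg (fun r : ℚ => (r : ℝ)) (Nat.totient_eq_mul_prod_factors P)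
      push_cast at h
      exact h
    have h2 : ∏ p ∈ P.primeFactors, (1 - (p : ℝ)⁻¹) ≤ δ / 2 := by
      calc ∏ p ∈ P.primeFactors, (1 - (p : ℝ)⁻¹)
          ≤ ∏ p ∈ P.primeFactors, Real.exp (-(p : ℝ)⁻¹) :=
            Finset.prod_le_prod (fun p hp => by
              have : (1 : ℝ) ≤ p := by
                exact_mod_cast (Nat.prime_of_mem_primeFactors hp).one_le
              linarith [inv_le_one_of_one_le₀ this]) fun p _ => Real.one_sub_le_exp_neg _
        _ = Real.exp (-∑ p ∈ P.primeFactors, (p : ℝ)⁻¹) := by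
            rw [← Real.exp_sum, Finset.sum_neg_distrib]
        _ ≤ Real.exp (Real.log (δ / 2)) := by
            refine Real.exp_le_exp.mpr ?_
            have h3 := hk (k + 1) (Nat.le_succ k)
            have h4 : ∑ i ∈ Finset.range (k + 1),
                {p : ℕ | p.Prime}.indicator (fun n : ℕ => (1 : ℝ) / n) i =
                ∑ p ∈ P.primeFactors, (p : ℝ)⁻¹ := by
              rw [hP, primeFactors_primorial]
              simp [Set.indicator_apply, Nat.primesLE, Nat.primesBelow, Finset.sum_filter]
            rw [h4] at h3
            linarith
        _ = δ / 2 := Real.exp_log (by positivity)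
    rw [h1, mul_comm]
    gcongr
  -- The other `δ/2` absorbs the incomplete period modulo `P`.
  obtain ⟨N₀, hN₀⟩ := exists_nat_ge ((P : ℝ) / (δ / 2))
  refine ⟨k, N₀, fun N hN => ?_⟩
  have hsub : ((Finset.Icc 1 N).filter fun n => ∀ q, q.Prime → q ∣ n → k < q) ⊆
      (Finset.Ico 1 (1 + N)).filter fun n => P.Coprime n := by
    intro n hn
    simp only [Finset.mem_filter, Finset.mem_Icc, Finset.mem_Ico] at hn ⊢
    refine ⟨by omega, Nat.coprime_of_dvd fun q hq hqP hqn => ?_⟩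
    exact absurd (hn.2 q hq hqn) (not_lt.mpr (hq.dvd_primorial_iff.mp hqP))
  have hcard := (Finset.card_le_card hsub).trans (Nat.Ico_filter_coprime_le 1 N hP0)
  have hNr : (P : ℝ) ≤ δ / 2 * N := by
    rw [div_le_iff₀ (by positivity)] at hN₀
    have : (N₀ : ℝ) ≤ N := by exact_mod_cast hN
    nlinarith
  calc (_ : ℝ) ≤ ((P.totient * (N / P + 1) : ℕ) : ℝ) := by exact_mod_cast hcard
    _ ≤ P.totient * ((N : ℝ) / P) + P.totient := by
        push_cast
        rw [mul_add, mul_one]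
        gcongr
        exact Nat.cast_div_le
    _ ≤ δ / 2 * P * ((N : ℝ) / P) + P := by
        gcongr
        exact Nat.totient_le P
    _ = δ / 2 * N + P := by field_simp
    _ ≤ δ * N := by linarith

open scoped Classical in
/-- Few integers are divisible by the square of an integer exceeding `Y`. -/
theorem card_filter_sq_dvd_le (Y N : ℕ) :
    (((Finset.Icc 1 N).filter fun n => ∃ p, Y < p ∧ p ^ 2 ∣ n).card : ℝ) ≤ N * (2 / (Y + 1)) := by
  have hsub : ((Finset.Icc 1 N).filter fun n => ∃ p, Y < p ∧ p ^ 2 ∣ n) ⊆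
      (Finset.Ioo Y (N + 1)).biUnion fun p => (Finset.Ioc 0 N).filter fun n => p ^ 2 ∣ n := by
    intro n hn
    simp only [Finset.mem_filter, Finset.mem_Icc, Finset.mem_biUnion, Finset.mem_Ioo,
      Finset.mem_Ioc] at hn ⊢
    obtain ⟨⟨h1, h2⟩, p, hp, hpn⟩ := hn
    have := Nat.le_of_dvd h1 hpn
    exact ⟨p, ⟨hp, by nlinarith⟩, ⟨by omega, h2⟩, hpn⟩
  calc (_ : ℝ) ≤ ((∑ p ∈ Finset.Ioo Y (N + 1),
        ((Finset.Ioc 0 N).filter fun n => p ^ 2 ∣ n).card : ℕ) : ℝ) := by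
        exact_mod_cast (Finset.card_le_card hsub).trans Finset.card_biUnion_le
    _ ≤ ∑ p ∈ Finset.Ioo Y (N + 1), (N : ℝ) * ((p : ℝ) ^ 2)⁻¹ := by
        push_cast
        refine Finset.sum_le_sum fun p _ => ?_
        rw [Nat.Ioc_filter_dvd_card_eq_div, ← div_eq_mul_inv]
        exact_mod_cast Nat.cast_div_le (α := ℝ) (m := N) (n := p ^ 2)
    _ ≤ _ := by
        rw [← Finset.mul_sum]
        gcongr
        exact sum_Ioo_inv_sq_le Y (N + 1)

/-! ### Exceptional sets: smooth numbers -/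

/-- Legendre's formula gives `v_p(X!) ≤ X/(p-1) ≤ 2X/p` and `v_p(Y!) ≥ ⌊Y/p⌋ ≥ Y/(2p)`. Comparing
with `Y!` bounds the `Y`-smooth part of `X!` without estimates for sums over primes. -/
theorem Nat.Prime.mul_factorization_factorial_le {p Y X : ℕ} (hp : p.Prime) (hpY : p ≤ Y) :
    Y * X.factorial.factorization p ≤ 4 * X * Y.factorial.factorization p := by
  have h1 : (p - 1) * X.factorial.factorization p ≤ X := by
    rw [Nat.sub_one_mul_factorization_factorial hp]
    exact Nat.sub_le _ _
  have h2 : Y / p ≤ Y.factorial.factorization p := by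
    rw [Nat.factorization_factorial hp (Nat.lt_succ_self _)]
    calc Y / p = Y / p ^ 1 := by rw [pow_one]
      _ ≤ _ := Finset.single_le_sum (f := fun i => Y / p ^ i) (fun _ _ => Nat.zero_le _) (by
          have := Nat.log_pos hp.one_lt hpY
          simp only [Finset.mem_Ico]
          omega)
  have h3 : p * X.factorial.factorization p ≤ 2 * X := by
    obtain ⟨k, rfl⟩ : ∃ k, p = k + 1 := ⟨p - 1, by have := hp.one_lt; omega⟩
    have : 1 ≤ k := by have := hp.one_lt; omega
    simp only [Nat.add_sub_cancel] at h1
    nlinarith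
  have h4 : Y ≤ 2 * (Y / p) * p := by
    have h5 := Nat.div_add_mod Y p
    have h6 := Nat.mod_lt Y hp.pos
    have h7 : 1 ≤ Y / p := Nat.div_pos hpY hp.pos
    nlinarith
  calc Y * X.factorial.factorization p
      ≤ 2 * (Y / p) * p * X.factorial.factorization p := Nat.mul_le_mul_right _ h4
    _ = 2 * (Y / p) * (p * X.factorial.factorization p) := by ring
    _ ≤ 2 * Y.factorial.factorization p * (2 * X) := by gcongr
    _ = _ := by ring

open scoped Classical in
/-- The product of the `Y`-smooth numbers up to `X` is at most `Y ^ (4 X)`, in logarithmic form. -/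
theorem sum_log_smooth_le {X Y : ℕ} (hY : 1 ≤ Y) :
    ∑ n ∈ (Finset.Icc 1 X).filter (fun n => ∀ p, p.Prime → p ∣ n → p ≤ Y), Real.log n ≤
      4 * X * Real.log Y := by
  set S := (Finset.Icc 1 X).filter (fun n => ∀ p, p.Prime → p ∣ n → p ≤ Y) with hS
  set Q := ∏ n ∈ S, n with hQ
  have hS0 : ∀ n ∈ S, n ≠ 0 := fun n hn => by
    have := (Finset.mem_Icc.mp (Finset.mem_filter.mp hn).1).1
    omega
  have hQ0 : Q ≠ 0 := Finset.prod_ne_zero_iff.mpr hS0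
  have hQdvd : Q ∣ X.factorial := by
    rw [← Finset.prod_Ico_id_eq_factorial, Finset.Ico_add_one_right_eq_Icc]
    exact Finset.prod_dvd_prod_of_subset _ _ _ (Finset.filter_subset _ _)
  have hQle : ∀ p ∈ Q.primeFactors, p.Prime ∧ p ≤ Y := fun p hp => by
    have hp' := Nat.prime_of_mem_primeFactors hp
    obtain ⟨n, hn, hpn⟩ := (hp'.prime.dvd_finsetProd_iff _).mp (Nat.dvd_of_mem_primeFactors hp)
    exact ⟨hp', (Finset.mem_filter.mp hn).2 p hp' hpn⟩
  have hYpos : (0 : ℝ) < Y := by exact_mod_cast hY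
  have hlogQ : ∑ n ∈ S, Real.log n = Real.log Q := by
    rw [hQ, Nat.cast_prod, Real.log_prod fun n hn => by exact_mod_cast hS0 n hn]
  have hsub : Q.primeFactors ⊆ Y.factorial.primeFactors := fun p hp =>
    Nat.mem_primeFactors.mpr ⟨(hQle p hp).1,
      (hQle p hp).1.dvd_factorial.mpr (hQle p hp).2, Y.factorial_ne_zero⟩
  have hfact : Y * Real.log Q ≤ 4 * X * Real.log Y.factorial := by
    rw [Real.log_nat_eq_sum_factorization, Real.log_nat_eq_sum_factorization]
    simp only [Finsupp.sum, Nat.support_factorization]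
    rw [Finset.mul_sum, Finset.mul_sum]
    calc _ ≤ ∑ p ∈ Q.primeFactors, 4 * (X : ℝ) * (Y.factorial.factorization p * Real.log p) := by
          refine Finset.sum_le_sum fun p hp => ?_
          have h1 : Q.factorization p ≤ X.factorial.factorization p :=
            (Nat.factorization_le_iff_dvd hQ0 X.factorial_ne_zero).mpr hQdvd p
          have h2 : (Y * Q.factorization p : ℝ) ≤ 4 * X * Y.factorial.factorization p := by
            exact_mod_cast (Nat.mul_le_mul_left Y h1).trans
              ((hQle p hp).1.mul_factorization_factorial_le (hQle p hp).2)
          rw [← mul_assoc, ← mul_assoc]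
          exact mul_le_mul_of_nonneg_right h2 (Real.log_natCast_nonneg p)
      _ ≤ _ := Finset.sum_le_sum_of_subset_of_nonneg hsub fun p _ _ =>
          mul_nonneg (by positivity) (mul_nonneg (by positivity) (Real.log_natCast_nonneg p))
  have hYfac : Real.log Y.factorial ≤ Y * Real.log Y := by
    rw [← Real.log_pow]
    refine Real.log_le_log (by exact_mod_cast Y.factorial_pos) ?_
    exact_mod_cast Nat.factorial_le_pow Y
  rw [hlogQ]
  refine le_of_mul_le_mul_left ?_ hYpos
  calc Y * Real.log Q ≤ 4 * X * Real.log Y.factorial := hfact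
    _ ≤ 4 * X * (Y * Real.log Y) := by gcongr
    _ = _ := by ring

open scoped Classical in
/-- The number of `x ^ κ`-smooth integers up to `x` is at most `8κx + √x`. -/
theorem card_filter_smooth_le {x κ : ℝ} (hx : 1 < x) (hκ : 0 ≤ κ) :
    (((Finset.Icc 1 ⌊x⌋₊).filter
      (fun n => ∀ p, p.Prime → p ∣ n → p ≤ ⌊x ^ κ⌋₊)).card : ℝ) ≤ 8 * κ * x + √x := by
  set Y := ⌊x ^ κ⌋₊ with hY
  have hx0 : 0 < x := by linarith
  have hY1 : 1 ≤ Y := Nat.le_floor (by simpa using Real.one_le_rpow hx.le hκ)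
  have hlogx : 0 < Real.log x := Real.log_pos hx
  have hlogY : Real.log Y ≤ κ * Real.log x := by
    rw [← Real.log_rpow hx0]
    exact Real.log_le_log (by exact_mod_cast hY1) (Nat.floor_le (by positivity))
  set S := (Finset.Icc 1 ⌊x⌋₊).filter (fun n => ∀ p, p.Prime → p ∣ n → p ≤ Y) with hS
  -- Above `√x` each `n` contributes at least `(log x)/2` to the logarithmic sum, which turns that
  -- sum into a count.
  rw [← Finset.card_filter_add_card_filter_not (s := S) (fun n : ℕ => √x < n)]
  have hlow : ((S.filter fun n : ℕ => ¬ √x < n).card : ℝ) ≤ √x := by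
    calc ((S.filter fun n : ℕ => ¬ √x < n).card : ℝ) ≤ ((Finset.Icc 1 ⌊√x⌋₊).card : ℝ) := by
          refine Nat.cast_le.mpr (Finset.card_le_card fun n hn => ?_)
          simp only [hS, Finset.mem_filter, Finset.mem_Icc, not_lt] at hn ⊢
          exact ⟨hn.1.1.1, Nat.le_floor hn.2⟩
      _ = ⌊√x⌋₊ := by simp
      _ ≤ √x := Nat.floor_le (Real.sqrt_nonneg x)
  have hhigh : ((S.filter fun n : ℕ => √x < n).card : ℝ) ≤ 8 * κ * x := by
    have h1 : ((S.filter fun n : ℕ => √x < n).card : ℝ) * (Real.log x / 2) ≤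
        4 * x * (κ * Real.log x) := by
      calc _ = ∑ n ∈ S.filter (fun n : ℕ => √x < n), Real.log x / 2 := by
            rw [Finset.sum_const, nsmul_eq_mul]
        _ ≤ ∑ n ∈ S.filter (fun n : ℕ => √x < n), Real.log n := by
            refine Finset.sum_le_sum fun n hn => ?_
            rw [← Real.log_sqrt hx0.le]
            exact Real.log_le_log (Real.sqrt_pos.mpr hx0) (Finset.mem_filter.mp hn).2.le
        _ ≤ ∑ n ∈ S, Real.log n :=
            Finset.sum_le_sum_of_subset_of_nonneg (Finset.filter_subset _ _)
              fun n _ _ => Real.log_natCast_nonneg n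
        _ ≤ 4 * ⌊x⌋₊ * Real.log Y := sum_log_smooth_le hY1
        _ ≤ 4 * x * (κ * Real.log x) := by
            gcongr
            exact Nat.floor_le hx0.le
    refine le_of_mul_le_mul_right ?_ (half_pos hlogx)
    linarith
  push_cast
  linarith

/-! ### Pairs with a common cofactor -/

/-- Pairs `(m p, m p')` with a common cofactor `m ≤ z s(m)` and prescribed values `a`, `b` of `s`
are few: `s(m)` divides `a - b`, and `m ≡ a` modulo `s(m)`. -/
theorem card_fiber_le {z a b : ℕ} {D : ℝ} (hD : a ≠ b → (((a : ℤ) - b).natAbs.divisors.card : ℝ) ≤ D)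
    (hD0 : 0 ≤ D) (F : Finset (ℕ × ℕ)) (m p : ℕ → ℕ)
    (hF : ∀ u ∈ F, u.1 ≠ u.2 ∧ m u.1 = m u.2 ∧ m u.1 * p u.1 = u.1 ∧ m u.2 * p u.2 = u.2 ∧
      0 < m u.1 ∧ m u.1 ≤ z * sumProperDivisors (m u.1) ∧
      a = sumProperDivisors (m u.1) * p u.1 + sumProperDivisors (m u.1) + m u.1 ∧
      b = sumProperDivisors (m u.2) * p u.2 + sumProperDivisors (m u.2) + m u.2) :
    (F.card : ℝ) ≤ z * D := by
  by_cases hab : a = b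
  · have : F = ∅ := by
      refine Finset.eq_empty_of_forall_notMem fun u hu => ?_
      obtain ⟨hne, hm, h1, h2, hpos, hz, ha, hb⟩ := hF u hu
      have hs : 0 < sumProperDivisors (m u.1) := by
        rcases Nat.eq_zero_or_pos (sumProperDivisors (m u.1)) with h | h
        · simp [h] at hz; omega
        · exact h
      rw [← hm] at hb h2
      have : sumProperDivisors (m u.1) * p u.1 = sumProperDivisors (m u.1) * p u.2 := by omega
      have := Nat.eq_of_mul_eq_mul_left hs this
      exact hne (by rw [← h1, ← h2, this])
    rw [this]
    simpa using by positivity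
  set h := ((a : ℤ) - b).natAbs with hh
  have hh0 : h ≠ 0 := by omega
  -- Candidates for `m`, with `t` in the role of `s(m)`.
  set T : Finset ℕ := h.divisors.biUnion fun t =>
    (Finset.Icc 1 (z * t)).filter fun k => k ≡ a [MOD t] with hT
  have hTcard : T.card ≤ h.divisors.card * z := by
    refine Finset.card_biUnion_le_card_mul _ _ _ fun t ht => ?_
    have ht0 : 0 < t := Nat.pos_of_mem_divisors ht
    calc _ ≤ (Finset.range z).card := by
          -- Within one residue class modulo `t`, `k` is recovered from this quotient; the shift by
          -- 1 keeps `k = z t` in range.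
          refine Finset.card_le_card_of_injOn (fun k => (k - 1) / t) (fun k hk => ?_) ?_
          · simp only [Finset.coe_filter, Finset.mem_Icc, Set.mem_ofPred_eq, Finset.coe_range,
              Set.mem_Iio] at hk ⊢
            rw [Nat.div_lt_iff_lt_mul ht0]
            omega
          · intro k hk l hl hkl
            simp only [Finset.coe_filter, Finset.mem_Icc, Set.mem_ofPred_eq] at hk hl hkl
            have hmod : (k - 1) % t = (l - 1) % t := by
              have : k ≡ l [MOD t] := hk.2.trans hl.2.symm
              have : (k - 1) + 1 ≡ (l - 1) + 1 [MOD t] := by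
                rwa [Nat.sub_add_cancel hk.1.1, Nat.sub_add_cancel hl.1.1]
              exact Nat.ModEq.add_right_cancel' 1 this
            have e1 := Nat.div_add_mod (k - 1) t
            have e2 := Nat.div_add_mod (l - 1) t
            rw [hkl, hmod, e2] at e1
            omega
      _ = z := Finset.card_range z
  have hFT : F.card ≤ T.card := by
    refine Finset.card_le_card_of_injOn (fun u => m u.1) (fun u hu => ?_) ?_
    · obtain ⟨hne, hm, h1, h2, hpos, hz, ha, hb⟩ := hF u hu
      simp only [hT, Finset.coe_biUnion, Set.mem_iUnion, Finset.mem_coe, Finset.mem_filter,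
        Finset.mem_Icc, exists_prop, Nat.mem_divisors]
      refine ⟨sumProperDivisors (m u.1), ⟨?_, hh0⟩, ⟨hpos, hz⟩, ?_⟩
      · rw [hh, ← Int.natCast_dvd]
        refine ⟨(p u.1 : ℤ) - p u.2, ?_⟩
        rw [ha, hb, ← hm]
        push_cast
        ring
      · have hdvd : sumProperDivisors (m u.1) ∣ a - m u.1 :=
          ⟨p u.1 + 1, by rw [ha, Nat.add_sub_cancel]; ring⟩
        exact (Nat.modEq_iff_dvd' (by omega)).mpr hdvd
    · intro u hu v hv huv
      obtain ⟨hne, hm, h1, h2, hpos, hz, ha, hb⟩ := hF u hu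
      obtain ⟨hne', hm', h1', h2', hpos', hz', ha', hb'⟩ := hF v hv
      have huv : m u.1 = m v.1 := huv
      have hs : 0 < sumProperDivisors (m u.1) := by
        rcases Nat.eq_zero_or_pos (sumProperDivisors (m u.1)) with h | h
        · simp [h] at hz; omega
        · exact h
      rw [← hm] at hb h2
      rw [← hm'] at hb' h2'
      rw [← huv] at ha' hb' h1' h2'
      have e1 : sumProperDivisors (m u.1) * p u.1 = sumProperDivisors (m u.1) * p v.1 := by omega
      have e2 : sumProperDivisors (m u.1) * p u.2 = sumProperDivisors (m u.1) * p v.2 := by omega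
      have e1 := Nat.eq_of_mul_eq_mul_left hs e1
      have e2 := Nat.eq_of_mul_eq_mul_left hs e2
      exact Prod.ext (by rw [← h1, ← h1', e1]) (by rw [← h2, ← h2', e2])
  calc (F.card : ℝ) ≤ ((h.divisors.card * z : ℕ) : ℝ) := by exact_mod_cast hFT.trans hTcard
    _ = z * h.divisors.card := by push_cast; ring
    _ ≤ z * D := by gcongr; exact hD hab

/-- Cauchy–Schwarz over the cofactor `m`. -/
theorem sq_card_le_of_factorization {z M : ℕ} {D : ℝ} (hD0 : 0 ≤ D) (A G : Finset ℕ) (m p : ℕ → ℕ)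
    (hGA : ∀ n ∈ G, sumProperDivisors n ∈ A)
    (hD : ∀ n ∈ G, ∀ n' ∈ G, sumProperDivisors n ≠ sumProperDivisors n' →
      (((sumProperDivisors n : ℤ) - sumProperDivisors n').natAbs.divisors.card : ℝ) ≤ D)
    (hG : ∀ n ∈ G, (p n).Prime ∧ ¬ p n ∣ m n ∧ m n * p n = n ∧ 0 < m n ∧ m n ≤ M ∧
      m n ≤ z * sumProperDivisors (m n)) :
    (G.card : ℝ) ^ 2 ≤ M * (G.card + z * D * (A.card : ℝ) ^ 2) := by
  classical
  set R := (G ×ˢ G).filter fun u => m u.1 = m u.2 with hR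
  have hmaps : Set.MapsTo m (G : Set ℕ) (Finset.Icc 1 M : Finset ℕ) := fun n hn =>
    Finset.mem_coe.mpr (Finset.mem_Icc.mpr ⟨(hG n hn).2.2.2.1, (hG n hn).2.2.2.2.1⟩)
  have hRcard : R.card = ∑ k ∈ Finset.Icc 1 M, (G.filter fun n => m n = k).card ^ 2 := by
    rw [Finset.card_eq_sum_card_fiberwise (f := fun u : ℕ × ℕ => m u.1) (t := Finset.Icc 1 M)
      (fun u hu => hmaps (Finset.mem_product.mp (Finset.mem_filter.mp hu).1).1)]
    refine Finset.sum_congr rfl fun k _ => ?_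
    rw [sq, ← Finset.card_product]
    congr 1
    ext u
    simp only [Finset.mem_filter, Finset.mem_product]
    constructor
    · rintro ⟨⟨⟨h1, h2⟩, h3⟩, h4⟩
      exact ⟨⟨h1, h4⟩, h2, h3 ▸ h4⟩
    · rintro ⟨⟨h1, h4⟩, h2, h3⟩
      exact ⟨⟨⟨h1, h2⟩, h4.trans h3.symm⟩, h4⟩
  have hCS : (G.card : ℝ) ^ 2 ≤ M * R.card := by
    have h1 := Finset.card_eq_sum_card_fiberwise hmaps
    have h2 := sq_sum_le_card_mul_sum_sq (s := Finset.Icc 1 M)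
      (f := fun k => (G.filter fun n => m n = k).card)
    rw [← h1, ← hRcard, Nat.card_Icc, Nat.add_sub_cancel] at h2
    exact_mod_cast h2
  have hdiag : (R.filter fun u => u.1 = u.2).card ≤ G.card := by
    refine Finset.card_le_card_of_injOn Prod.fst (fun u hu => ?_) ?_
    · exact (Finset.mem_product.mp (Finset.mem_filter.mp (Finset.mem_filter.mp hu).1).1).1
    · intro u hu v hv huv
      exact Prod.ext huv (((Finset.mem_filter.mp hu).2.symm.trans huv).trans
        (Finset.mem_filter.mp hv).2)
  set O := R.filter fun u => ¬ u.1 = u.2 with hO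
  have hOmem : ∀ u ∈ O, u.1 ∈ G ∧ u.2 ∈ G ∧ m u.1 = m u.2 ∧ u.1 ≠ u.2 := fun u hu => by
    simp only [hO, hR, Finset.mem_filter, Finset.mem_product] at hu
    exact ⟨hu.1.1.1, hu.1.1.2, hu.1.2, hu.2⟩
  have hoff : (O.card : ℝ) ≤ z * D * (A.card : ℝ) ^ 2 := by
    rw [Finset.card_eq_sum_card_fiberwise (t := A ×ˢ A)
      (f := fun u : ℕ × ℕ => (sumProperDivisors u.1, sumProperDivisors u.2))
      (fun u hu => Finset.mem_coe.mpr (Finset.mem_product.mpr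
        ⟨hGA _ (hOmem u hu).1, hGA _ (hOmem u hu).2.1⟩))]
    push_cast
    calc _ ≤ ∑ _ab ∈ A ×ˢ A, (z : ℝ) * D := by
          refine Finset.sum_le_sum fun ab _ => ?_
          set F := O.filter fun u => (sumProperDivisors u.1, sumProperDivisors u.2) = ab with hFdef
          -- The divisor bound is available only for differences of values attained on `G`, so a
          -- witness `w` is needed.
          rcases F.eq_empty_or_nonempty with hF | ⟨w, hw⟩
          · rw [hF]
            simpa using by positivity
          have hFab : ∀ u ∈ F, u ∈ O ∧ sumProperDivisors u.1 = ab.1 ∧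
              sumProperDivisors u.2 = ab.2 := fun u hu => by
            have := Finset.mem_filter.mp hu
            exact ⟨this.1, congrArg Prod.fst this.2, congrArg Prod.snd this.2⟩
          refine card_fiber_le (a := ab.1) (b := ab.2) (fun hne => ?_) hD0 F m p fun u hu => ?_
          · obtain ⟨hwO, h1, h2⟩ := hFab w hw
            rw [← h1, ← h2] at hne ⊢
            exact hD _ (hOmem w hwO).1 _ (hOmem w hwO).2.1 hne
          · obtain ⟨huO, h1, h2⟩ := hFab u hu
            obtain ⟨g1, g2, hm, hne⟩ := hOmem u huO
            obtain ⟨p1, d1, e1, pos, -, hz⟩ := hG _ g1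
            obtain ⟨p2, d2, e2, -⟩ := hG _ g2
            refine ⟨hne, hm, e1, e2, pos, hz, ?_, ?_⟩
            · rw [← sumProperDivisors_mul_prime p1 d1, e1, h1]
            · rw [← sumProperDivisors_mul_prime p2 d2, e2, h2]
      _ = _ := by
          rw [Finset.sum_const, Finset.card_product, nsmul_eq_mul]
          push_cast
          ring
  have hsplit := Finset.card_filter_add_card_filter_not (s := R) (fun u : ℕ × ℕ => u.1 = u.2)
  have hRle : (R.card : ℝ) ≤ G.card + z * D * (A.card : ℝ) ^ 2 := by
    rw [← hsplit]
    push_cast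
    have : ((R.filter fun u => u.1 = u.2).card : ℝ) ≤ G.card := by exact_mod_cast hdiag
    linarith
  exact hCS.trans (by gcongr)

/-- The integers in `Icc 1 ⌊x⌋₊` with a prime factor `≤ z` and a simple prime factor `> x ^ κ`
whose `s`-value lies in `A` are few when `A` has at most `x ^ (1/2 + κ/8)` elements. -/
theorem sq_card_le_of_large_prime_factor {x κ C : ℝ} {z : ℕ} (hx : 1 ≤ x) (hκ : 0 < κ)
    (hC : 0 < C)
    (hdiv : ∀ n : ℕ, n ≠ 0 → (n.divisors.card : ℝ) ≤ C * (n : ℝ) ^ (κ / 16))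
    (hz : z ≤ ⌊x ^ κ⌋₊) (A G : Finset ℕ) (hA : (A.card : ℝ) ≤ x ^ (1 / 2 + κ / 8))
    (hGx : G ⊆ Finset.Icc 1 ⌊x⌋₊) (hGA : ∀ n ∈ G, sumProperDivisors n ∈ A)
    (hp : ∀ n ∈ G, ∃ p, p.Prime ∧ p ∣ n ∧ ⌊x ^ κ⌋₊ < p ∧ ¬ p ^ 2 ∣ n)
    (hq : ∀ n ∈ G, ∃ q, q.Prime ∧ q ∣ n ∧ q ≤ z) :
    (G.card : ℝ) ^ 2 ≤ (1 + z * C) * x ^ (2 - κ / 2) := by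
  have hx0 : 0 < x := by linarith
  choose! p hpp hpn hpY hpsq using hp
  have hmem : ∀ n ∈ G, 1 ≤ n ∧ (n : ℝ) ≤ x := fun n hn => by
    obtain ⟨h1, h2⟩ := Finset.mem_Icc.mp (hGx hn)
    exact ⟨h1, (Nat.cast_le.mpr h2).trans (Nat.floor_le hx0.le)⟩
  have hmul : ∀ n ∈ G, n / p n * p n = n := fun n hn => Nat.div_mul_cancel (hpn n hn)
  have hmpos : ∀ n ∈ G, 0 < n / p n := fun n hn =>
    Nat.div_pos (Nat.le_of_dvd (hmem n hn).1 (hpn n hn)) (hpp n hn).pos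
  have hs : ∀ n ∈ G, (sumProperDivisors n : ℝ) ≤ x ^ 2 := fun n hn => by
    calc (sumProperDivisors n : ℝ) ≤ (n : ℝ) ^ 2 := by exact_mod_cast sumProperDivisors_le_sq n
      _ ≤ x ^ 2 := by gcongr; exact (hmem n hn).2
  have hD : ∀ n ∈ G, ∀ n' ∈ G, sumProperDivisors n ≠ sumProperDivisors n' →
      (((sumProperDivisors n : ℤ) - sumProperDivisors n').natAbs.divisors.card : ℝ) ≤
        C * x ^ (κ / 8) := by
    intro n hn n' hn' hne
    set h := ((sumProperDivisors n : ℤ) - sumProperDivisors n').natAbs with hh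
    have hle : (h : ℝ) ≤ x ^ 2 := by
      rcases le_total (sumProperDivisors n) (sumProperDivisors n') with hc | hc
      · exact (Nat.cast_le.mpr (by omega : h ≤ sumProperDivisors n')).trans (hs n' hn')
      · exact (Nat.cast_le.mpr (by omega : h ≤ sumProperDivisors n)).trans (hs n hn)
    calc (h.divisors.card : ℝ) ≤ C * (h : ℝ) ^ (κ / 16) := hdiv h (by omega)
      _ ≤ C * (x ^ 2) ^ (κ / 16) := by gcongr
      _ = C * x ^ (κ / 8) := by
          rw [← Real.rpow_natCast, ← Real.rpow_mul hx0.le]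
          congr 2
          push_cast
          ring
  have key := sq_card_le_of_factorization (z := z) (M := ⌊x ^ (1 - κ)⌋₊)
    (by positivity) A G (fun n => n / p n) p hGA hD fun n hn => by
      refine ⟨hpp n hn, fun hdvd => hpsq n hn ?_, hmul n hn, hmpos n hn, ?_, ?_⟩
      · have h := Nat.mul_dvd_mul_right hdvd (p n)
        rwa [hmul n hn, ← sq] at h
      · refine Nat.le_floor ?_
        have h1 : x ^ κ < p n := (Nat.floor_lt (by positivity)).mp (hpY n hn)
        have h2 : ((n / p n : ℕ) : ℝ) * p n ≤ x := by
          rw [← Nat.cast_mul, hmul n hn]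
          exact (hmem n hn).2
        rw [Real.rpow_sub hx0, Real.rpow_one, le_div_iff₀ (by positivity)]
        exact (mul_le_mul_of_nonneg_left h1.le (by positivity)).trans h2
      · obtain ⟨q, hqp, hqn, hqz⟩ := hq n hn
        -- Since `q ≤ z ≤ ⌊x ^ κ⌋₊ < p n`, the small prime survives in the cofactor.
        have hqm : q ∣ n / p n := by
          have hqn' := hqn
          rw [← hmul n hn, hqp.dvd_mul] at hqn'
          rcases hqn' with h | h
          · exact h
          · have := (Nat.prime_dvd_prime_iff_eq hqp (hpp n hn)).mp h
            have := hpY n hn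
            omega
        exact (le_mul_sumProperDivisors_of_dvd (hmpos n hn).ne' hqp.one_lt hqm).trans
          (Nat.mul_le_mul_right _ hqz)
  have hGcard : (G.card : ℝ) ≤ x ^ (1 + κ / 2) := by
    calc (G.card : ℝ) ≤ ((Finset.Icc 1 ⌊x⌋₊).card : ℝ) := by exact_mod_cast Finset.card_le_card hGx
      _ = ⌊x⌋₊ := by simp
      _ ≤ x := Nat.floor_le hx0.le
      _ = x ^ (1 : ℝ) := (Real.rpow_one x).symm
      _ ≤ _ := Real.rpow_le_rpow_of_exponent_le hx (by linarith)
  -- Exponents: `κ/8 + 2 (1/2 + κ/8) = 1 + 3κ/8`, below `1 + κ/2`.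
  have hQ : z * (C * x ^ (κ / 8)) * (A.card : ℝ) ^ 2 ≤ z * C * x ^ (1 + κ / 2) := by
    calc z * (C * x ^ (κ / 8)) * (A.card : ℝ) ^ 2
        ≤ z * (C * x ^ (κ / 8)) * (x ^ (1 / 2 + κ / 8)) ^ 2 := by gcongr
      _ = z * C * (x ^ (κ / 8) * x ^ ((1 / 2 + κ / 8) * (2 : ℕ))) := by
          rw [Real.rpow_mul_natCast hx0.le]
          ring
      _ = z * C * x ^ (1 + 3 * κ / 8) := by
          rw [← Real.rpow_add hx0]
          congr 2
          push_cast
          ring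
      _ ≤ z * C * x ^ (1 + κ / 2) := by
          exact mul_le_mul_of_nonneg_left (Real.rpow_le_rpow_of_exponent_le hx (by linarith))
            (by positivity)
  calc (G.card : ℝ) ^ 2
      ≤ ⌊x ^ (1 - κ)⌋₊ * (G.card + z * (C * x ^ (κ / 8)) * (A.card : ℝ) ^ 2) := key
    _ ≤ x ^ (1 - κ) * (x ^ (1 + κ / 2) + z * C * x ^ (1 + κ / 2)) := by
        gcongr
        exact Nat.floor_le (by positivity)
    _ = (1 + z * C) * (x ^ (1 - κ) * x ^ (1 + κ / 2)) := by ring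
    _ = _ := by
        rw [← Real.rpow_add hx0]
        congr 2
        ring

/-! ### Choice of parameters and conclusion -/

theorem theorem1p1 (ε : ℝ → ℝ) (hε : Filter.Tendsto ε Filter.atTop (nhds 0)) :
    ∀ δ : ℝ, 0 < δ → ∃ x₀ : ℝ, ∀ x : ℝ, x₀ ≤ x →
      ∀ A : Finset ℕ, (∀ a ∈ A, 0 < a) → (A.card : ℝ) ≤ x ^ ((1 : ℝ) / 2 + ε x) →
        ((preimagesUpTo A x).card : ℝ) ≤ δ * x := by
  classical
  intro δ hδ
  -- Makes the smooth-number term `8κx` equal to `δx/8`.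
  set κ : ℝ := δ / 64 with hκdef
  have hκ : 0 < κ := by positivity
  have hκδ : κ ≤ δ / 64 := le_rfl
  obtain ⟨C, hC, hdiv⟩ := exists_card_divisors_le_mul_rpow (θ := κ / 16) (by positivity)
  obtain ⟨z, N₀, hrough⟩ := exists_card_filter_no_small_prime_le (δ := δ / 4) (by positivity)
  have hpow := tendsto_rpow_atTop hκ
  have hev : ∀ᶠ x : ℝ in Filter.atTop, 1 < x ∧ (N₀ : ℝ) ≤ x ∧ ε x < κ / 8 ∧ 8 / δ ≤ √x ∧
      (z : ℝ) ≤ x ^ κ ∧ 16 / δ ≤ x ^ κ ∧ (1 + z * C) * (64 / δ ^ 2) ≤ x ^ (κ / 2) := by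
    filter_upwards [Filter.eventually_gt_atTop 1, Filter.eventually_ge_atTop (N₀ : ℝ),
      hε.eventually_lt_const (show (0 : ℝ) < κ / 8 by positivity),
      Real.tendsto_sqrt_atTop.eventually_ge_atTop (8 / δ),
      hpow.eventually_ge_atTop (z : ℝ), hpow.eventually_ge_atTop (16 / δ),
      (tendsto_rpow_atTop (half_pos hκ)).eventually_ge_atTop ((1 + z * C) * (64 / δ ^ 2))]
      with x h1 h2 h3 h4 h5 h6 h7
    exact ⟨h1, h2, h3, h4, h5, h6, h7⟩
  obtain ⟨x₀, hx₀⟩ := hev.exists_forall_of_atTop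
  refine ⟨x₀, fun x hx A _ hA => ?_⟩
  obtain ⟨hx1, hxN, hεx, hsqrt, hzx, hYx, hfin⟩ := hx₀ x hx
  have hx0 : 0 < x := by linarith
  have hfloor : (⌊x⌋₊ : ℝ) ≤ x := Nat.floor_le hx0.le
  set Y := ⌊x ^ κ⌋₊ with hY
  set S₁ := (Finset.Icc 1 ⌊x⌋₊).filter (fun n => ∀ p, p.Prime → p ∣ n → p ≤ Y) with hS₁
  set S₂ := (Finset.Icc 1 ⌊x⌋₊).filter (fun n => ∃ p, Y < p ∧ p ^ 2 ∣ n) with hS₂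
  -- The shares of `δx` for `S₁`, `S₂`, `S₃` and `G` are 1/4, 1/8, 1/4 and 1/8, in total 3/4.
  set S₃ := (Finset.Icc 1 ⌊x⌋₊).filter (fun n => ∀ q, q.Prime → q ∣ n → z < q) with hS₃
  set G := preimagesUpTo A x \ (S₁ ∪ S₂ ∪ S₃) with hG
  have h₁ : (S₁.card : ℝ) ≤ δ / 4 * x := by
    have h := card_filter_smooth_le hx1 hκ.le
    have hs : √x ≤ δ / 8 * x := by
      have h8 : 1 ≤ δ / 8 * √x := by
        rw [div_le_iff₀ hδ] at hsqrt
        linarith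
      calc √x = 1 * √x := (one_mul _).symm
        _ ≤ δ / 8 * √x * √x := by gcongr
        _ = δ / 8 * x := by rw [mul_assoc, Real.mul_self_sqrt hx0.le]
    have hk : 8 * κ * x ≤ δ / 8 * x := by gcongr; linarith
    linarith
  have h₂ : (S₂.card : ℝ) ≤ δ / 8 * x := by
    have hY1 : 16 / δ ≤ (Y : ℝ) + 1 := hYx.trans (Nat.lt_floor_add_one _).le
    calc (S₂.card : ℝ) ≤ ⌊x⌋₊ * (2 / (Y + 1)) := card_filter_sq_dvd_le Y _
      _ ≤ x * (2 / (16 / δ)) := by gcongr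
      _ = δ / 8 * x := by field_simp; norm_num
  have h₃ : (S₃.card : ℝ) ≤ δ / 4 * x :=
    (hrough _ (Nat.le_floor hxN)).trans (by gcongr)
  have hGsub : G ⊆ preimagesUpTo A x := Finset.sdiff_subset
  have hGmem : ∀ n ∈ G, n ∈ Finset.Icc 1 ⌊x⌋₊ ∧ sumProperDivisors n ∈ A := fun n hn =>
    Finset.mem_filter.mp (hGsub hn)
  have hGnot : ∀ n ∈ G, n ∉ S₁ ∧ n ∉ S₂ ∧ n ∉ S₃ := fun n hn => by
    have := (Finset.mem_sdiff.mp hn).2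
    simp only [Finset.mem_union, not_or] at this
    exact ⟨this.1.1, this.1.2, this.2⟩
  have h₄ : (G.card : ℝ) ≤ δ / 8 * x := by
    have hsq := sq_card_le_of_large_prime_factor (z := z) hx1.le hκ hC hdiv (Nat.le_floor hzx) A G
      (hA.trans (Real.rpow_le_rpow_of_exponent_le hx1.le (by linarith)))
      (fun n hn => (hGmem n hn).1) (fun n hn => (hGmem n hn).2)
      (fun n hn => by
        obtain ⟨n1, n2, -⟩ := hGnot n hn
        have n1 : ¬ ∀ p, p.Prime → p ∣ n → p ≤ Y := fun h =>
          n1 (Finset.mem_filter.mpr ⟨(hGmem n hn).1, h⟩)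
        push Not at n1
        obtain ⟨p, hp, hpn, hpY⟩ := n1
        exact ⟨p, hp, hpn, hpY, fun h =>
          n2 (Finset.mem_filter.mpr ⟨(hGmem n hn).1, p, hpY, h⟩)⟩)
      (fun n hn => by
        have n3 : ¬ ∀ q, q.Prime → q ∣ n → z < q := fun h =>
          (hGnot n hn).2.2 (Finset.mem_filter.mpr ⟨(hGmem n hn).1, h⟩)
        push Not at n3
        exact n3)
    refine le_of_sq_le_sq (hsq.trans ?_) (by positivity)
    have hxk : 0 < x ^ (κ / 2) := by positivity
    rw [Real.rpow_sub hx0, Real.rpow_two, mul_pow, mul_div_assoc', div_le_iff₀ hxk]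
    have h5 : 1 + z * C ≤ (δ / 8) ^ 2 * x ^ (κ / 2) := by
      calc 1 + z * C = (δ / 8) ^ 2 * ((1 + z * C) * (64 / δ ^ 2)) := by field_simp; norm_num
        _ ≤ _ := by gcongr
    calc (1 + z * C) * x ^ 2 ≤ (δ / 8) ^ 2 * x ^ (κ / 2) * x ^ 2 := by gcongr
      _ = _ := by ring
  have hcover : preimagesUpTo A x ⊆ G ∪ (S₁ ∪ S₂ ∪ S₃) := fun n hn => by
    by_cases h : n ∈ S₁ ∪ S₂ ∪ S₃
    · exact Finset.mem_union_right _ h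
    · exact Finset.mem_union_left _ (Finset.mem_sdiff.mpr ⟨hn, h⟩)
  have hcard : (preimagesUpTo A x).card ≤ G.card + (S₁.card + S₂.card + S₃.card) :=
    (Finset.card_le_card hcover).trans ((Finset.card_union_le _ _).trans
      (Nat.add_le_add_left ((Finset.card_union_le _ _).trans
        (Nat.add_le_add_right (Finset.card_union_le _ _) _)) _))
  have hcard' : ((preimagesUpTo A x).card : ℝ) ≤ G.card + (S₁.card + S₂.card + S₃.card) := by
    exact_mod_cast hcard
  have : 0 < δ * x := by positivity
  linarith
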